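/- **Theorem (connectivity of $G^m(n,p)$).** For $n\ge 1$, $m\ge 1$ and $p\in[0,1]$ let $G(n,p)$ denote the Erdős–Rényi random graph on the vertex set $\{1,\dots,n\}$, in which each of the $\binom n2$ possible edges is present independently with probability $p$, and let $G^m(n,p)$ denote the union of $m$ independent copies of $G(n,p)$ (two vertices are adjacent in $G^m(n,p)$ if and only if they are adjacent in at least one of the $m$ copies). Let $c\in\mathbb R$ be a constant and let $m=m(n)\ge 1$ be any sequence of positive integers (for example a constant one). If $p=p(n)\in[0,1]$ satisfies $$p=\frac{\log n+c}{mn}$$ for all sufficiently large $n$, then $$\lim_{n\to\infty}\mathbb P\bigl(G^m(n,p)\text{ is connected}\bigr)=e^{-e^{-c}}.$$ -/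

import Mathlib

open MeasureTheory ProbabilityTheory Filter Topology unitInterval

namespace SimpleGraph

/-- The law `G^m(V, p)` of the union of `m` independent Erdős–Rényi (binomial) random graphs on the
vertex set `V`, each with edge probability `p`: two vertices are adjacent in the union when they are
adjacent in at least one of the `m` graphs. -/
noncomputable def unionBinomialRandom (V : Type*) (m : ℕ) (p : I) : Measure (SimpleGraph V) :=
  (Measure.pi fun _ : Fin m ↦ binomialRandom V p).map fun g ↦ ⨆ k, g k

/-- Taking the union of `m` graphs is measurable, so that the push-forward in
`unionBinomialRandom` is the genuine law of the union. -/
lemma measurable_iSup_graph {V : Type*} (m : ℕ) :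
    Measurable fun g : Fin m → SimpleGraph V ↦ ⨆ k, g k := by
  refine measurable_comap_iff.2 (measurable_pi_iff.2 fun u ↦ measurable_pi_iff.2 fun v ↦ ?_)
  simp only [Function.comp_apply, iSup_adj]
  refine Measurable.exists fun k ↦ ?_
  have h : Measurable fun G : SimpleGraph V ↦ G.Adj u v :=
    (measurable_pi_apply v).comp ((measurable_pi_apply u).comp (comap_measurable _))
  exact h.comp (measurable_pi_apply k)

instance {V : Type*} [Countable V] (m : ℕ) (p : I) :
    IsProbabilityMeasure (unionBinomialRandom V m p) :=
  Measure.isProbabilityMeasure_map (measurable_iSup_graph m).aemeasurable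

end SimpleGraph

/-!
The union of `m` independent copies of `G(n, p)` is itself a binomial random graph: the events
"no edge of `H` is present", for `H` finite, form a π-system that determines the law of a random
graph, and for the union they have probability `((1 - p) ^ m) ^ |E(H)|`. So let `q = (1 - p) ^ m` be
the probability that an edge is absent, and suppose that the expected number `n q ^ n`
(up to a factor tending to `1`) of isolated vertices tends to `r`.

By inclusion–exclusion the probability that there is no isolated vertex is the alternating sum over
`k` of the expected numbers of `k`-sets of isolated vertices, which tends to `∑ (-r) ^ k / k !`.
A disconnected graph without isolated vertices has a set `S` of at most `n / 2` vertices, not all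
isolated, that no edge leaves. The expected number of such `S` with `k` elements is
`C(n, k) (q ^ (k (n - k)) - q ^ (k (n - (k + 1) / 2)))`, and both terms tend to `r ^ k / k !`: a
set that no edge leaves typically consists of isolated vertices. All these terms are at most
`(B √(k + 1)) ^ k / k !`, which is summable, so the limits may be taken termwise.
-/

namespace ErdosRenyi

open SimpleGraph

section Law

lemma setBernoulli_setOf_disjoint {ι : Type*} {u t : Set ι} (p : I) (ht : t.Finite) (htu : t ⊆ u) :
    setBer(u, p) {s | Disjoint s t} = (toNNReal (σ p) : ENNReal) ^ t.ncard := by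
  lift t to Finset ι using ht
  have hpre : (fun f : ι → Prop ↦ {i | f i}) ⁻¹' {s | Disjoint s (t : Set ι)} =
      Set.pi t fun _ ↦ {False} := by
    ext f
    simp [Set.disjoint_right]
  rw [setBernoulli_apply', hpre, Measure.infinitePi_pi _ fun _ _ ↦ measurableSet_singleton _,
    Set.ncard_coe_finset]
  exact Finset.prod_eq_pow_card fun i hi ↦ by simp [htu hi]

variable {V : Type*} {H : SimpleGraph V}

lemma measurableSet_setOf_disjoint (hH : H.edgeSet.Finite) :
    MeasurableSet {G : SimpleGraph V | Disjoint G H} := by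
  have heq : {G : SimpleGraph V | Disjoint G H} = ⋂ e ∈ H.edgeSet, edgeSet ⁻¹' {s | e ∉ s} := by
    ext G
    simp [← disjoint_edgeSet, Set.disjoint_right]
  rw [heq]
  exact .biInter hH.countable fun e _ ↦ measurable_edgeSet (measurableSet_notMem e)

lemma isPiSystem_setOf_disjoint :
    IsPiSystem {A | ∃ H : SimpleGraph V, H.edgeSet.Finite ∧ {G | Disjoint G H} = A} := by
  rintro _ ⟨H₁, h₁, rfl⟩ _ ⟨H₂, h₂, rfl⟩ -
  refine ⟨H₁ ⊔ H₂, by simpa using h₁.union h₂, ?_⟩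
  ext G
  simp

lemma generateFrom_setOf_disjoint :
    MeasurableSpace.generateFrom
      {A | ∃ H : SimpleGraph V, H.edgeSet.Finite ∧ {G | Disjoint G H} = A} =
      (inferInstance : MeasurableSpace (SimpleGraph V)) := by
  refine le_antisymm (MeasurableSpace.generateFrom_le ?_) fun A hA ↦ ?_
  · rintro _ ⟨H, hH, rfl⟩
    exact measurableSet_setOf_disjoint hH
  · refine (@measurable_iff_adj V _ (.generateFrom _) id).2 (fun u v ↦ ?_) hA
    refine (@measurableSet_setOfPred _ (.generateFrom _) _).1 (.of_compl
      (MeasurableSpace.measurableSet_generateFrom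
        ⟨edge u v, (Set.finite_singleton s(u, v)).subset edgeSet_edge_subset, ?_⟩))
    ext G
    simp [disjoint_edge]

lemma ext_of_setOf_disjoint {μ ν : Measure (SimpleGraph V)} [IsFiniteMeasure μ]
    (h : ∀ H : SimpleGraph V, H.edgeSet.Finite → μ {G | Disjoint G H} = ν {G | Disjoint G H}) :
    μ = ν := by
  refine ext_of_generate_finite _ generateFrom_setOf_disjoint.symm isPiSystem_setOf_disjoint ?_ ?_
  · rintro _ ⟨H, hH, rfl⟩
    exact h H hH
  · simpa using h ⊥ (by simp)

variable [Countable V]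

lemma binomialRandom_setOf_disjoint (p : I) (hH : H.edgeSet.Finite) :
    binomialRandom V p {G | Disjoint G H} = (toNNReal (σ p) : ENNReal) ^ H.edgeSet.ncard := by
  rw [binomialRandom_eq_map, Measure.map_apply measurable_fromEdgeSet
    (measurableSet_setOf_disjoint hH),
    ← setBernoulli_setOf_disjoint p hH H.edgeSet_subset_compl_diagSet]
  simp

lemma unionBinomialRandom_setOf_disjoint (m : ℕ) (p : I) (hH : H.edgeSet.Finite) :
    unionBinomialRandom V m p {G | Disjoint G H} =
      ((toNNReal (σ p) : ENNReal) ^ m) ^ H.edgeSet.ncard := by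
  have hpre : (fun g : Fin m → SimpleGraph V ↦ ⨆ k, g k) ⁻¹' {G | Disjoint G H} =
      Set.pi Set.univ fun _ ↦ {G | Disjoint G H} := by
    ext g
    simp [iSup_disjoint_iff]
  rw [unionBinomialRandom, Measure.map_apply (measurable_iSup_graph m)
    (measurableSet_setOf_disjoint hH), hpre, Measure.pi_pi]
  simp only [binomialRandom_setOf_disjoint p hH, Finset.prod_const, Finset.card_univ,
    Fintype.card_fin, pow_right_comm]

theorem unionBinomialRandom_eq_binomialRandom (m : ℕ) (p : I) :
    unionBinomialRandom V m p = binomialRandom V (σ (σ p ^ m)) := by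
  refine ext_of_setOf_disjoint fun H hH ↦ ?_
  have hpow : toNNReal (σ p ^ m) = toNNReal (σ p) ^ m := by ext; simp
  rw [unionBinomialRandom_setOf_disjoint m p hH, binomialRandom_setOf_disjoint _ hH, symm_symm,
    hpow, ENNReal.coe_pow]

lemma binomialRandom_real_setOf_disjoint (p : I) (hH : H.edgeSet.Finite) :
    (binomialRandom V p).real {G | Disjoint G H} = (1 - (p : ℝ)) ^ H.edgeSet.ncard := by
  simp [measureReal_def, binomialRandom_setOf_disjoint p hH]

end Law

section Cuts

variable {V : Type*} {G : SimpleGraph V}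

lemma disjoint_top_between_iff {s t : Set V} :
    Disjoint G ((⊤ : SimpleGraph V).between s t) ↔ ∀ u ∈ s, ∀ v ∈ t, ¬ G.Adj u v := by
  rw [← disjoint_edgeSet, Set.disjoint_left, Sym2.forall]
  simp only [mem_edgeSet, between_adj, top_adj]
  refine ⟨fun h u hu v hv huv ↦ h u v huv ⟨huv.ne, .inl ⟨hu, hv⟩⟩, ?_⟩
  rintro h u v huv ⟨-, ⟨hu, hv⟩ | ⟨hu, hv⟩⟩
  exacts [h u hu v hv huv, h v hv u hu huv.symm]

variable [Fintype V]

lemma exists_disjoint_between_compl_of_not_preconnected (hG : ¬ G.Preconnected) :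
    ∃ S : Finset V, S.Nonempty ∧ 2 * S.card ≤ Fintype.card V ∧
      Disjoint G ((⊤ : SimpleGraph V).between S (S : Set V)ᶜ) := by
  classical
  simp only [Preconnected, not_forall] at hG
  obtain ⟨u, v, huv⟩ := hG
  let C : Finset V := {w | G.Reachable u w}
  have hcut : ∀ a ∈ C, ∀ b ∉ C, ¬ G.Adj a b := fun a ha b hb hab ↦
    hb (by simpa [C] using (by simpa [C] using ha : G.Reachable u a).trans hab.reachable)
  have hcard := C.card_add_card_compl
  simp only [disjoint_top_between_iff]
  rcases le_total C.card Cᶜ.card with h | h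
  · exact ⟨C, ⟨u, by simp [C]⟩, by lia, hcut⟩
  · refine ⟨Cᶜ, ⟨v, by simpa [C] using huv⟩, by lia, fun a ha b hb hab ↦ ?_⟩
    exact hcut b (by simpa using hb) a (by simpa using ha) hab.symm

lemma exists_disjoint_between_compl_of_not_connected [Nonempty V] (hG : ¬ G.Connected)
    (hiso : ∀ v, ¬ G.IsIsolated v) :
    ∃ S : Finset V, 2 * S.card ≤ Fintype.card V ∧
      Disjoint G ((⊤ : SimpleGraph V).between S (S : Set V)ᶜ) ∧
      ¬ Disjoint G ((⊤ : SimpleGraph V).between S Set.univ) := by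
  obtain ⟨S, ⟨v, hv⟩, hcard, hcut⟩ :=
    exists_disjoint_between_compl_of_not_preconnected fun h ↦ hG ⟨h⟩
  refine ⟨S, hcard, hcut, fun h ↦ hiso v fun w ↦ ?_⟩
  exact disjoint_top_between_iff.1 h v hv w (Set.mem_univ w)

variable (S : Finset V)

lemma ncard_edgeSet_top_between_compl :
    (((⊤ : SimpleGraph V).between S (S : Set V)ᶜ).edgeSet.ncard : ℝ) =
      (Fintype.card V - S.card) * S.card := by
  classical
  set H := (⊤ : SimpleGraph V).between S (S : Set V)ᶜ with hH
  have hdegree (v : V) (hv : v ∈ S) : H.degree v = Sᶜ.card := by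
    rw [degree]
    congr 1
    ext w
    simp only [hH, mem_neighborFinset, between_adj, top_adj, Set.mem_compl_iff, Finset.mem_coe,
      Finset.mem_compl]
    grind
  have hbip : H.IsBipartiteWith S ((Sᶜ : Finset V) : Set V) := by
    rw [Finset.coe_compl]
    exact between_isBipartiteWith disjoint_compl_right
  rw [← coe_edgeFinset, Set.ncard_coe_finset, ← isBipartiteWith_sum_degrees_eq_card_edges hbip,
    Finset.sum_const_nat hdegree, Finset.card_compl, Nat.cast_mul, Nat.cast_sub S.card_le_univ,
    mul_comm]

lemma ncard_edgeSet_top_between_univ :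
    (((⊤ : SimpleGraph V).between S Set.univ).edgeSet.ncard : ℝ) =
      (Fintype.card V - (S.card + 1) / 2) * S.card := by
  classical
  set H := (⊤ : SimpleGraph V).between S Set.univ with hH
  have hin (v : V) (hv : v ∈ S) : (H.degree v : ℝ) = Fintype.card V - 1 := by
    have : H.neighborFinset v = Finset.univ.erase v := by
      ext w
      simp [hH, between_adj, hv, eq_comm]
    rw [degree, this, Finset.card_erase_of_mem (Finset.mem_univ v), Finset.card_univ,
      Nat.cast_pred (Fintype.card_pos_iff.2 ⟨v⟩)]
  have hout (v : V) (hv : v ∈ Sᶜ) : (H.degree v : ℝ) = S.card := by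
    have : H.neighborFinset v = S := by
      ext w
      rw [Finset.mem_compl] at hv
      simp only [hH, mem_neighborFinset, between_adj, top_adj, Finset.mem_coe, Set.mem_univ]
      grind
    rw [degree, this]
  have hsum : (∑ v, (H.degree v : ℝ)) = 2 * H.edgeFinset.card := by
    exact_mod_cast H.sum_degrees_eq_twice_card_edges
  rw [← Finset.sum_add_sum_compl S, Finset.sum_congr rfl hin, Finset.sum_congr rfl hout,
    Finset.sum_const, Finset.sum_const, nsmul_eq_mul, nsmul_eq_mul, Finset.card_compl,
    Nat.cast_sub S.card_le_univ] at hsum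
  rw [← coe_edgeFinset, Set.ncard_coe_finset]
  linarith

end Cuts

lemma measureReal_compl_biUnion_eq_sum_powerset {Ω ι : Type*} {mΩ : MeasurableSpace Ω}
    {μ : Measure Ω} [IsProbabilityMeasure μ] {t : Finset ι} {A : ι → Set Ω}
    (hA : ∀ i ∈ t, MeasurableSet (A i)) :
    μ.real (⋃ i ∈ t, A i)ᶜ = ∑ u ∈ t.powerset, (-1) ^ u.card * μ.real (⋂ i ∈ u, A i) := by
  have hempty : t.powerset.filter (fun u ↦ ¬ u.Nonempty) = {∅} := by
    ext u
    simp only [Finset.mem_filter, Finset.mem_powerset, Finset.not_nonempty_iff_eq_empty,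
      Finset.mem_singleton, and_iff_right_iff_imp]
    exact fun h ↦ h ▸ t.empty_subset
  rw [probReal_compl_eq_one_sub (t.measurableSet_biUnion hA),
    measureReal_biUnion_eq_sum_powerset hA,
    ← Finset.sum_filter_add_sum_filter_not t.powerset (fun u ↦ u.Nonempty), hempty]
  simp [pow_succ, add_comm]

section FiniteGraphs

/-- The expected number of `k`-element vertex sets `S` in a random graph on `n` vertices for which
`k * (n - d)` prescribed edges are all absent, `q` being the probability that a given edge is
absent. The edges leaving `S` correspond to `d = k`, the edges meeting `S` to `d = (k + 1) / 2`. -/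
noncomputable def expectedAvoiding (q : ℝ) (n k : ℕ) (d : ℝ) : ℝ :=
  n.choose k * (q ^ (n - d)) ^ k

variable {V : Type*} (p : I)

lemma binomialRandom_real_setOf_connected_le [Countable V] [Nontrivial V] :
    (binomialRandom V p).real {G | G.Connected} ≤
      (binomialRandom V p).real {G | ∀ v, ¬ G.IsIsolated v} :=
  measureReal_mono fun _ hG ↦ hG.preconnected.not_isIsolated

lemma binomialRandom_real_setOf_disjoint_eq_rpow [Finite V] {H : SimpleGraph V} {x : ℝ}
    {k : ℕ} (hH : (H.edgeSet.ncard : ℝ) = x * k) :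
    (binomialRandom V p).real {G | Disjoint G H} = ((1 - (p : ℝ)) ^ x) ^ k := by
  rw [binomialRandom_real_setOf_disjoint p (Set.toFinite _), ← Real.rpow_natCast, hH,
    Real.rpow_mul_natCast (one_minus_nonneg p)]

variable [Fintype V]

lemma sum_finset_apply_card (f : ℕ → ℝ) :
    ∑ S : Finset V, f S.card =
      ∑ k ∈ Finset.range (Fintype.card V + 1), (Fintype.card V).choose k * f k := by
  rw [← Finset.powerset_univ, Finset.sum_powerset_apply_card, Finset.card_univ]
  simp only [nsmul_eq_mul]

lemma binomialRandom_real_setOf_forall_not_isIsolated :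
    (binomialRandom V p).real {G | ∀ v, ¬ G.IsIsolated v} =
      ∑ k ∈ Finset.range (Fintype.card V + 1),
        (-1) ^ k * expectedAvoiding (1 - p) (Fintype.card V) k ((k + 1) / 2) := by
  have hInter (S : Finset V) : ⋂ v ∈ S, {G : SimpleGraph V | G.IsIsolated v} =
      {G | Disjoint G ((⊤ : SimpleGraph V).between S Set.univ)} := by
    ext G
    simp [disjoint_top_between_iff, IsIsolated]
  have hmeas (v : V) : MeasurableSet {G : SimpleGraph V | G.IsIsolated v} := by
    have hv := hInter {v}
    rw [Finset.set_biInter_singleton] at hv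
    exact hv ▸ measurableSet_setOf_disjoint (Set.toFinite _)
  have hcompl : {G : SimpleGraph V | ∀ v, ¬ G.IsIsolated v} =
      (⋃ v ∈ (Finset.univ : Finset V), {G | G.IsIsolated v})ᶜ := by
    ext G
    simp
  rw [hcompl, measureReal_compl_biUnion_eq_sum_powerset fun v _ ↦ hmeas v, Finset.powerset_univ]
  simp only [hInter,
    binomialRandom_real_setOf_disjoint_eq_rpow p (ncard_edgeSet_top_between_univ _)]
  rw [sum_finset_apply_card
    fun k ↦ (-1) ^ k * ((1 - (p : ℝ)) ^ ((Fintype.card V : ℝ) - (k + 1) / 2)) ^ k]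
  simp only [expectedAvoiding, mul_left_comm]

lemma binomialRandom_real_setOf_disjoint_sdiff (S : Finset V) :
    (binomialRandom V p).real ({G | Disjoint G ((⊤ : SimpleGraph V).between S (S : Set V)ᶜ)} \
      {G | Disjoint G ((⊤ : SimpleGraph V).between S Set.univ)}) =
      ((1 - (p : ℝ)) ^ ((Fintype.card V : ℝ) - S.card)) ^ S.card -
        ((1 - (p : ℝ)) ^ ((Fintype.card V : ℝ) - (S.card + 1) / 2)) ^ S.card := by
  have hsub : {G | Disjoint G ((⊤ : SimpleGraph V).between S Set.univ)} ⊆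
      {G | Disjoint G ((⊤ : SimpleGraph V).between S (S : Set V)ᶜ)} := fun G hG ↦
    disjoint_top_between_iff.2 fun u hu v _ ↦ disjoint_top_between_iff.1 hG u hu v (Set.mem_univ v)
  rw [measureReal_sdiff hsub (measurableSet_setOf_disjoint (Set.toFinite _)),
    binomialRandom_real_setOf_disjoint_eq_rpow p (ncard_edgeSet_top_between_compl S),
    binomialRandom_real_setOf_disjoint_eq_rpow p (ncard_edgeSet_top_between_univ S)]

lemma binomialRandom_real_setOf_forall_not_isIsolated_le [Nonempty V] :
    (binomialRandom V p).real {G | ∀ v, ¬ G.IsIsolated v} ≤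
      (binomialRandom V p).real {G | G.Connected} +
        ∑ k ∈ Finset.range (Fintype.card V + 1) with 2 * k ≤ Fintype.card V,
          (expectedAvoiding (1 - p) (Fintype.card V) k k -
            expectedAvoiding (1 - p) (Fintype.card V) k ((k + 1) / 2)) := by
  have hcover : {G : SimpleGraph V | ∀ v, ¬ G.IsIsolated v} ⊆ {G | G.Connected} ∪
      ⋃ S ∈ Finset.univ.filter (fun S : Finset V ↦ 2 * S.card ≤ Fintype.card V),
        {G | Disjoint G ((⊤ : SimpleGraph V).between S (S : Set V)ᶜ)} \
          {G | Disjoint G ((⊤ : SimpleGraph V).between S Set.univ)} := by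
    intro G hG
    refine or_iff_not_imp_left.2 fun hconn ↦ ?_
    obtain ⟨S, hS, hcut, hmeet⟩ := exists_disjoint_between_compl_of_not_connected hconn hG
    exact Set.mem_biUnion (Finset.mem_filter.2 ⟨Finset.mem_univ S, hS⟩) ⟨hcut, hmeet⟩
  refine (measureReal_mono hcover).trans <| (measureReal_union_le _ _).trans <|
    add_le_add_right ((measureReal_biUnion_finset_le _ _).trans_eq ?_) _
  simp only [binomialRandom_real_setOf_disjoint_sdiff]
  rw [Finset.sum_filter, Finset.sum_filter, sum_finset_apply_card fun k ↦
    if 2 * k ≤ Fintype.card V then ((1 - (p : ℝ)) ^ ((Fintype.card V : ℝ) - k)) ^ k -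
      ((1 - (p : ℝ)) ^ ((Fintype.card V : ℝ) - (k + 1) / 2)) ^ k else 0]
  simp only [expectedAvoiding, mul_ite, mul_zero, mul_sub]

end FiniteGraphs

section Asymptotics

lemma rpow_div_self_le {x y : ℝ} (hx : 1 ≤ x) (hy : 0 ≤ y) (hyx : y ≤ x + 1) :
    x ^ (y / x) ≤ 2 * (1 + y) := by
  have bernoulli {t : ℝ} (ht₀ : 0 ≤ t) (ht₁ : t ≤ 1) : x ^ t ≤ 1 + t * x :=
    (Real.rpow_le_rpow (by linarith) (by linarith) ht₀).trans
      (rpow_one_add_le_one_add_mul_self (by linarith) ht₀ ht₁)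
  have hsplit : y / x = y / (x + 1) + y / (x + 1) * (1 / x) := by field_simp
  have ht : y / (x + 1) ≤ 1 := (div_le_one (by linarith)).2 hyx
  have hfirst : x ^ (y / (x + 1)) ≤ 1 + y := (bernoulli (by positivity) ht).trans <| by
    rw [div_mul_eq_mul_div, add_le_add_iff_left, div_le_iff₀ (by linarith)]
    nlinarith
  have hsecond : x ^ (y / (x + 1) * (1 / x)) ≤ 2 := calc
    x ^ (y / (x + 1) * (1 / x)) ≤ x ^ (1 / x) := by
      gcongr
      exact mul_le_of_le_one_left (by positivity) ht
    _ ≤ 1 + 1 / x * x := bernoulli (by positivity) ((div_le_one (by linarith)).2 hx)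
    _ = 2 := by field_simp; norm_num
  rw [hsplit, Real.rpow_add (by linarith), mul_comm 2]
  gcongr

-- A bound on `x ^ (d / x)` linear in `d` would not do: it leads to the terms `(B k) ^ k / k !`,
-- whose sum diverges for large `B`.
lemma rpow_div_self_le_two_mul_sqrt {x d : ℝ} (hx : 1 ≤ x) (hd : 0 ≤ d) (hdx : 2 * d ≤ x + 1) :
    x ^ (d / x) ≤ 2 * √(d + 1 / 2) := by
  have hsq : (x ^ (d / x)) ^ 2 ≤ (2 * √(d + 1 / 2)) ^ 2 := calc
    (x ^ (d / x)) ^ 2 = x ^ (2 * d / x) := by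
      rw [← Real.rpow_mul_natCast (by linarith), Nat.cast_ofNat, div_mul_eq_mul_div, mul_comm d]
    _ ≤ 2 * (1 + 2 * d) := rpow_div_self_le hx (by linarith) hdx
    _ ≤ (2 * √(d + 1 / 2)) ^ 2 := by
      rw [mul_pow, Real.sq_sqrt (by linarith)]
      linarith
  exact (sq_le_sq₀ (by positivity) (by positivity)).1 hsq

lemma mul_rpow_sub_eq {x q : ℝ} (hx : 0 < x) (hq : 0 ≤ q) (d : ℝ) :
    x * q ^ (x - d) = (x * q ^ x) ^ (1 - d / x) * x ^ (d / x) := by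
  rw [Real.mul_rpow hx.le (by positivity), ← Real.rpow_mul hq, mul_right_comm,
    ← Real.rpow_add hx, sub_add_cancel, Real.rpow_one, mul_one_sub, mul_div_cancel₀ _ hx.ne']

lemma mul_rpow_sub_le {x q C d : ℝ} (hx : 1 ≤ x) (hq : 0 ≤ q) (hC : 1 ≤ C) (hqC : x * q ^ x ≤ C)
    (hd : 0 ≤ d) (hdx : 2 * d ≤ x + 1) :
    x * q ^ (x - d) ≤ 2 * C * √(d + 1 / 2) := by
  have hexp : 0 ≤ 1 - d / x := sub_nonneg.2 ((div_le_one (by linarith)).2 (by linarith))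
  calc x * q ^ (x - d) = (x * q ^ x) ^ (1 - d / x) * x ^ (d / x) :=
        mul_rpow_sub_eq (by linarith) hq d
    _ ≤ C * (2 * √(d + 1 / 2)) := by
        gcongr
        · calc (x * q ^ x) ^ (1 - d / x) ≤ C ^ (1 - d / x) := by gcongr
            _ ≤ C := Real.rpow_le_self_of_one_le hC (sub_le_self _ (by positivity))
        · exact rpow_div_self_le_two_mul_sqrt hx hd hdx
    _ = 2 * C * √(d + 1 / 2) := by ring

lemma expectedAvoiding_nonneg {q : ℝ} (hq : 0 ≤ q) (n k : ℕ) (d : ℝ) :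
    0 ≤ expectedAvoiding q n k d := by
  unfold expectedAvoiding
  positivity

lemma expectedAvoiding_le {q C d : ℝ} {n k : ℕ} (hn : 1 ≤ n) (hq : 0 ≤ q) (hC : 1 ≤ C)
    (hqC : n * q ^ n ≤ C) (hd : 0 ≤ d) (hdn : 2 * d ≤ n + 1) (hdk : d ≤ k + 1 / 2) :
    expectedAvoiding q n k d ≤ (2 * C * √(k + 1)) ^ k / k.factorial := by
  have hqC' : n * q ^ (n : ℝ) ≤ C := by rwa [Real.rpow_natCast]
  calc expectedAvoiding q n k d ≤ n ^ k / k.factorial * (q ^ (n - d)) ^ k :=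
        mul_le_mul_of_nonneg_right (Nat.choose_le_pow_div k n) (by positivity)
    _ = (n * q ^ (n - d)) ^ k / k.factorial := by ring
    _ ≤ (2 * C * √(d + 1 / 2)) ^ k / k.factorial := by
        gcongr ?_ ^ k / _
        exact mul_rpow_sub_le (by exact_mod_cast hn) hq hC hqC' hd hdn
    _ ≤ (2 * C * √(k + 1)) ^ k / k.factorial := by
        gcongr (2 * C * √?_) ^ k / _
        linarith

lemma mul_sqrt_pow_div_factorial_le {B : ℝ} (hB : 0 ≤ B) (k : ℕ) :
    (B * √(k + 1)) ^ k / k.factorial ≤ Real.exp 1 * (B * Real.exp 1 / √(k + 1)) ^ k := by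
  have hfact : ((k : ℝ) + 1) ^ k / k.factorial ≤ Real.exp 1 * Real.exp 1 ^ k := by
    refine (Real.pow_div_factorial_le_exp _ (by positivity) k).trans_eq ?_
    rw [Real.exp_one_pow, ← Real.exp_add, add_comm]
  have hsqrt : B * √(k + 1) = B / √(k + 1) * (k + 1) := by
    rw [div_mul_eq_mul_div, mul_div_assoc, Real.div_sqrt]
  calc (B * √(k + 1)) ^ k / k.factorial = (B / √(k + 1)) ^ k * ((k + 1) ^ k / k.factorial) := by
        rw [hsqrt, mul_pow, mul_div_assoc]
    _ ≤ (B / √(k + 1)) ^ k * (Real.exp 1 * Real.exp 1 ^ k) := by gcongr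
    _ = Real.exp 1 * (B * Real.exp 1 / √(k + 1)) ^ k := by ring

lemma summable_mul_sqrt_pow_div_factorial {B : ℝ} (hB : 0 ≤ B) :
    Summable fun k : ℕ ↦ (B * √(k + 1)) ^ k / k.factorial := by
  have hratio : Tendsto (fun k : ℕ ↦ B * Real.exp 1 / √((k : ℝ) + 1)) atTop (𝓝 0) :=
    tendsto_const_nhds.div_atTop <| Real.tendsto_sqrt_atTop.comp <|
      tendsto_atTop_add_const_right _ 1 tendsto_natCast_atTop_atTop
  have hgeom : Summable fun k : ℕ ↦ Real.exp 1 * (1 / 2 : ℝ) ^ k :=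
    summable_geometric_two.mul_left _
  refine hgeom.of_norm_bounded_eventually_nat ?_
  filter_upwards [hratio.eventually_le_const (by norm_num : (0 : ℝ) < 1 / 2)] with k hk
  rw [Real.norm_of_nonneg (by positivity)]
  refine (mul_sqrt_pow_div_factorial_le hB k).trans ?_
  gcongr

lemma tendsto_sum_range_succ_of_dominated {E : Type*} [NormedAddCommGroup E] [CompleteSpace E]
    {f : ℕ → ℕ → E} {g : ℕ → E} {bound : ℕ → ℝ} (hbound : Summable bound)
    (hlim : ∀ k, Tendsto (f · k) atTop (𝓝 (g k)))
    (hle : ∀ᶠ n in atTop, ∀ k ≤ n, ‖f n k‖ ≤ bound k) :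
    Tendsto (fun n ↦ ∑ k ∈ Finset.range (n + 1), f n k) atTop (𝓝 (∑' k, g k)) := by
  have hbound₀ (k : ℕ) : 0 ≤ bound k := by
    obtain ⟨n, hn, hkn⟩ := (hle.and (eventually_ge_atTop k)).exists
    exact (norm_nonneg _).trans (hn k hkn)
  have htsum (n : ℕ) : ∑ k ∈ Finset.range (n + 1), f n k = ∑' k, if k ≤ n then f n k else 0 := by
    rw [tsum_eq_sum (s := Finset.range (n + 1)) fun k hk ↦ if_neg (by simpa using hk)]
    exact Finset.sum_congr rfl fun k hk ↦ (if_pos (Finset.mem_range_succ_iff.1 hk)).symm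
  simp only [htsum]
  refine tendsto_tsum_of_dominated_convergence hbound (fun k ↦ ?_) ?_
  · refine (hlim k).congr' ?_
    filter_upwards [eventually_ge_atTop k] with n hn using (if_pos hn).symm
  · filter_upwards [hle] with n hn k
    split_ifs with hk
    exacts [hn k hk, norm_zero.trans_le (hbound₀ k)]

variable {q : ℕ → ℝ} {r : ℝ}

lemma tendsto_mul_rpow_sub (hq : ∀ n, 0 ≤ q n)
    (h : Tendsto (fun n : ℕ ↦ n * q n ^ n) atTop (𝓝 r)) (d : ℝ) :
    Tendsto (fun n : ℕ ↦ n * q n ^ (n - d)) atTop (𝓝 r) := by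
  have hexp : Tendsto (fun n : ℕ ↦ 1 - d / (n : ℝ)) atTop (𝓝 1) := by
    simpa using (tendsto_const_div_atTop_nhds_zero_nat d).const_sub 1
  have hroot : Tendsto (fun n : ℕ ↦ (n : ℝ) ^ (d / n)) atTop (𝓝 1) := by
    simpa [Function.comp_def] using
      (tendsto_rpow_div_mul_add d 1 0 zero_ne_one).comp tendsto_natCast_atTop_atTop
  have hprod := (h.rpow hexp (.inr one_pos)).mul hroot
  rw [Real.rpow_one, mul_one] at hprod
  refine hprod.congr' ?_
  filter_upwards [eventually_gt_atTop 0] with n hn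
  rw [mul_rpow_sub_eq (by exact_mod_cast hn) (hq n), Real.rpow_natCast]

lemma tendsto_expectedAvoiding (hq : ∀ n, 0 ≤ q n)
    (h : Tendsto (fun n : ℕ ↦ n * q n ^ n) atTop (𝓝 r)) (k : ℕ) (d : ℝ) :
    Tendsto (fun n ↦ expectedAvoiding (q n) n k d) atTop (𝓝 (r ^ k / k.factorial)) :=
  tendsto_choose_mul_pow_atTop k (tendsto_mul_rpow_sub hq h d)

lemma exists_summable_forall_expectedAvoiding_le (hq : ∀ n, 0 ≤ q n)
    (h : Tendsto (fun n : ℕ ↦ n * q n ^ n) atTop (𝓝 r)) :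
    ∃ bound : ℕ → ℝ, Summable bound ∧ ∀ᶠ n : ℕ in atTop, ∀ (k : ℕ) (d : ℝ), 0 ≤ d →
      2 * d ≤ n + 1 → d ≤ k + 1 / 2 → expectedAvoiding (q n) n k d ≤ bound k := by
  obtain ⟨C, hrC, hC⟩ : ∃ C, r < C ∧ 1 ≤ C := ⟨max (r + 1) 1, by simp, le_max_right _ _⟩
  refine ⟨_, summable_mul_sqrt_pow_div_factorial (by linarith : 0 ≤ 2 * C), ?_⟩
  filter_upwards [h.eventually_le_const hrC, eventually_ge_atTop 1] with n hqC hn k d hd hdn hdk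
  exact expectedAvoiding_le hn (hq n) hC hqC hd hdn hdk

lemma tendsto_sum_neg_one_pow_mul_expectedAvoiding (hq : ∀ n, 0 ≤ q n)
    (h : Tendsto (fun n : ℕ ↦ n * q n ^ n) atTop (𝓝 r)) :
    Tendsto (fun n ↦ ∑ k ∈ Finset.range (n + 1),
      (-1) ^ k * expectedAvoiding (q n) n k ((k + 1) / 2)) atTop (𝓝 (Real.exp (-r))) := by
  have hexp : Real.exp (-r) = ∑' k : ℕ, (-1) ^ k * (r ^ k / k.factorial) := by
    simp only [Real.exp_eq_exp_ℝ, NormedSpace.exp_eq_tsum_div, neg_pow r, mul_div_assoc]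
  obtain ⟨bound, hbound, hle⟩ := exists_summable_forall_expectedAvoiding_le hq h
  rw [hexp]
  refine tendsto_sum_range_succ_of_dominated hbound
    (fun k ↦ (tendsto_expectedAvoiding hq h k _).const_mul _) ?_
  filter_upwards [hle] with n hn k hk
  have hk' : (k : ℝ) ≤ n := by exact_mod_cast hk
  rw [norm_mul, norm_pow, norm_neg, norm_one, one_pow, one_mul,
    Real.norm_of_nonneg (expectedAvoiding_nonneg (hq n) n k _)]
  exact hn k _ (by positivity) (by linarith) (by linarith)

lemma tendsto_sum_expectedAvoiding_sub (hq : ∀ n, 0 ≤ q n)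
    (h : Tendsto (fun n : ℕ ↦ n * q n ^ n) atTop (𝓝 r)) :
    Tendsto (fun n ↦ ∑ k ∈ Finset.range (n + 1) with 2 * k ≤ n,
      (expectedAvoiding (q n) n k k - expectedAvoiding (q n) n k ((k + 1) / 2)))
      atTop (𝓝 0) := by
  obtain ⟨bound, hbound, hle⟩ := exists_summable_forall_expectedAvoiding_le hq h
  simp only [Finset.sum_filter]
  suffices Tendsto _ atTop (𝓝 (∑' _ : ℕ, (0 : ℝ))) by simpa only [tsum_zero] using this
  refine tendsto_sum_range_succ_of_dominated hbound (fun k ↦ ?_) ?_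
  · have hsub := (tendsto_expectedAvoiding hq h k k).sub
      (tendsto_expectedAvoiding hq h k ((k + 1) / 2))
    rw [sub_self] at hsub
    refine hsub.congr' ?_
    filter_upwards [eventually_ge_atTop (2 * k)] with n hn using (if_pos hn).symm
  · filter_upwards [hle] with n hn k hk
    have hk' : (k : ℝ) ≤ n := by exact_mod_cast hk
    have hiso := hn k ((k + 1) / 2) (by positivity) (by linarith) (by linarith)
    have hiso₀ := expectedAvoiding_nonneg (hq n) n k ((k + 1) / 2)
    split_ifs with h2k
    · have h2k' : 2 * (k : ℝ) ≤ n := by exact_mod_cast h2k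
      exact abs_sub_le_of_nonneg_of_le (expectedAvoiding_nonneg (hq n) n k k)
        (hn k k (by positivity) (by linarith) (by linarith)) hiso₀ hiso
    · rw [norm_zero]
      exact hiso₀.trans hiso

end Asymptotics

theorem tendsto_binomialRandom_real_setOf_connected {p : ℕ → I} {r : ℝ}
    (h : Tendsto (fun n : ℕ ↦ n * (1 - (p n : ℝ)) ^ n) atTop (𝓝 r)) :
    Tendsto (fun n : ℕ ↦ (binomialRandom (Fin n) (p n)).real {G | G.Connected}) atTop
      (𝓝 (Real.exp (-r))) := by
  have hq (n : ℕ) : 0 ≤ 1 - (p n : ℝ) := one_minus_nonneg (p n)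
  have hiso : Tendsto (fun n : ℕ ↦ (binomialRandom (Fin n) (p n)).real {G | ∀ v, ¬ G.IsIsolated v})
      atTop (𝓝 (Real.exp (-r))) := by
    simpa only [binomialRandom_real_setOf_forall_not_isIsolated, Fintype.card_fin] using
      tendsto_sum_neg_one_pow_mul_expectedAvoiding hq h
  have hlower := hiso.sub (tendsto_sum_expectedAvoiding_sub hq h)
  rw [sub_zero] at hlower
  refine tendsto_of_tendsto_of_tendsto_of_le_of_le' hlower hiso ?_ ?_
  all_goals
    filter_upwards [eventually_ge_atTop 2] with n hn
    have : Nontrivial (Fin n) := Fin.nontrivial_iff_two_le.2 hn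
  · have hle := binomialRandom_real_setOf_forall_not_isIsolated_le (V := Fin n) (p n)
    rw [Fintype.card_fin] at hle
    exact sub_le_iff_le_add.2 hle
  · exact binomialRandom_real_setOf_connected_le (p n)

lemma one_sub_mul_exp_pow_mem_Icc {x : ℝ} (hx₀ : 0 ≤ x) (hx₁ : x ≤ 1) (N : ℕ) :
    ((1 - x) * Real.exp x) ^ N ∈ Set.Icc (1 - N * x ^ 2) 1 := by
  have hupper : (1 - x) * Real.exp x ≤ 1 := calc
    (1 - x) * Real.exp x ≤ Real.exp (-x) * Real.exp x := by
      gcongr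
      exact Real.one_sub_le_exp_neg x
    _ = 1 := by rw [← Real.exp_add, neg_add_cancel, Real.exp_zero]
  have hlower : 1 - x ^ 2 ≤ (1 - x) * Real.exp x := by
    nlinarith [mul_le_mul_of_nonneg_left (Real.add_one_le_exp x) (sub_nonneg.2 hx₁)]
  refine ⟨?_, pow_le_one₀ (mul_nonneg (sub_nonneg.2 hx₁) (Real.exp_nonneg x)) hupper⟩
  calc 1 - N * x ^ 2 = 1 + N * (-x ^ 2) := by ring
    _ ≤ (1 + -x ^ 2) ^ N := one_add_mul_le_pow (by nlinarith) N
    _ ≤ ((1 - x) * Real.exp x) ^ N := by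
      rw [← sub_eq_add_neg]
      exact pow_le_pow_left₀ (by nlinarith) hlower N

lemma tendsto_one_sub_mul_exp_pow {α : Type*} {l : Filter α} {x : α → ℝ} {N : α → ℕ}
    (hx : ∀ a, x a ∈ I) (h : Tendsto (fun a ↦ N a * x a ^ 2) l (𝓝 0)) :
    Tendsto (fun a ↦ ((1 - x a) * Real.exp (x a)) ^ N a) l (𝓝 1) := by
  have hmem (a : α) := one_sub_mul_exp_pow_mem_Icc (hx a).1 (hx a).2 (N a)
  have hlower := h.const_sub 1
  rw [sub_zero] at hlower
  exact tendsto_of_tendsto_of_tendsto_of_le_of_le hlower tendsto_const_nhds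
    (fun a ↦ (hmem a).1) fun a ↦ (hmem a).2

lemma tendsto_log_add_sq_div (c : ℝ) :
    Tendsto (fun n : ℕ ↦ (Real.log n + c) ^ 2 / (n : ℝ)) atTop (𝓝 0) := by
  have hbigO : (fun x : ℝ ↦ Real.log x + c) =O[atTop] Real.log :=
    (Asymptotics.isBigO_refl _ _).add (Asymptotics.isLittleO_const_left.2
      (.inr (tendsto_norm_atTop_atTop.comp Real.tendsto_log_atTop))).isBigO
  exact ((hbigO.pow 2).trans_isLittleO Real.isLittleO_pow_log_id_atTop).tendsto_div_nhds_zero.comp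
    tendsto_natCast_atTop_atTop

lemma mul_one_sub_pow_eq {c x : ℝ} {n N : ℕ} (hn : n ≠ 0) (hx : N * x = Real.log n + c) :
    n * (1 - x) ^ N = Real.exp (-c) * ((1 - x) * Real.exp x) ^ N := by
  have hn' : (0 : ℝ) < n := by positivity
  rw [mul_pow, ← Real.exp_nat_mul, hx, Real.exp_add, Real.exp_log hn', Real.exp_neg]
  field_simp

lemma tendsto_mul_one_sub_pow {c : ℝ} {m : ℕ → ℕ} (hm : ∀ n, 1 ≤ m n) {p : ℕ → I}
    (hp : ∀ᶠ n : ℕ in atTop, (p n : ℝ) = (Real.log n + c) / (m n * n)) :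
    Tendsto (fun n : ℕ ↦ n * (1 - (p n : ℝ)) ^ (m n * n)) atTop (𝓝 (Real.exp (-c))) := by
  have hmul : ∀ᶠ n : ℕ in atTop, ((m n * n : ℕ) : ℝ) * p n = Real.log n + c := by
    filter_upwards [hp, eventually_ne_atTop 0] with n hpn hn
    have := hm n
    rw [hpn, Nat.cast_mul]
    field_simp
  have hsq : Tendsto (fun n : ℕ ↦ ((m n * n : ℕ) : ℝ) * (p n : ℝ) ^ 2) atTop (𝓝 0) := by
    refine squeeze_zero' (.of_forall fun n ↦ by positivity) ?_ (tendsto_log_add_sq_div c)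
    filter_upwards [hmul, eventually_gt_atTop 0] with n hmn hn
    have hm' : (1 : ℝ) ≤ m n := by exact_mod_cast hm n
    rw [← hmn, le_div_iff₀ (by positivity), Nat.cast_mul]
    calc (m n * n : ℝ) * (p n : ℝ) ^ 2 * n = m n * (n * p n : ℝ) ^ 2 := by ring
      _ ≤ (m n : ℝ) ^ 2 * (n * p n : ℝ) ^ 2 := by
        gcongr
        exact le_self_pow₀ hm' two_ne_zero
      _ = (m n * n * p n : ℝ) ^ 2 := by ring
  have hlim := (tendsto_one_sub_mul_exp_pow (fun n ↦ (p n).2) hsq).const_mul (Real.exp (-c))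
  rw [mul_one] at hlim
  refine hlim.congr' ?_
  filter_upwards [hmul, eventually_ne_atTop 0] with n hmn hn using (mul_one_sub_pow_eq hn hmn).symm

end ErdosRenyi

theorem mainTheorem3_general {m : ℕ → ℕ} {p : ℕ → I} {r : ℝ}
    (h : Tendsto (fun n : ℕ ↦ n * (1 - (p n : ℝ)) ^ (m n * n)) atTop (𝓝 r)) :
    Tendsto
      (fun n : ℕ ↦ (SimpleGraph.unionBinomialRandom (Fin n) (m n) (p n)).real
        {G : SimpleGraph (Fin n) | G.Connected})
      atTop (𝓝 (Real.exp (-r))) := by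
  simp only [ErdosRenyi.unionBinomialRandom_eq_binomialRandom]
  refine ErdosRenyi.tendsto_binomialRandom_real_setOf_connected ?_
  simpa [← pow_mul] using h

theorem mainTheorem3 (c : ℝ) (m : ℕ → ℕ) (hm : ∀ n, 1 ≤ m n) (p : ℕ → I)
    (hp : ∀ᶠ n : ℕ in atTop, (p n : ℝ) = (Real.log n + c) / (m n * n)) :
    Tendsto
      (fun n : ℕ ↦ (SimpleGraph.unionBinomialRandom (Fin n) (m n) (p n)).real
        {G : SimpleGraph (Fin n) | G.Connected})
      atTop (𝓝 (Real.exp (-Real.exp (-c)))) :=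
  mainTheorem3_general (ErdosRenyi.tendsto_mul_one_sub_pow hm hp)
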